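/- Let $k\ge 2$ be an integer and let $G$ be the finite graph obtained from a cycle $v_0v_1\cdots v_{2k-1}$ on $2k$ vertices by attaching one or more pendent vertices to each of the alternate vertices $v_0,v_2,\dots,v_{2k-2}$ (and none to the other cycle vertices). Then $G$ is a cactus, i.e. a connected graph in which any two distinct simple cycles have at most one vertex in common. Let $X$ be the set of cut vertices of $G$, and let $\operatorname{mvc}_X(G)$ be the minimum cardinality of a vertex cover of $G$ that contains $X$. The eternal vertex cover number $\operatorname{evc}(G)$ is the minimum number of guards with which a defender can win the following game. The defender first places the guards on vertices of $G$. In each round an attacker attacks an edge, and the defender responds by moving the guards in parallel, each guard staying where it is or moving to a neighbouring vertex, so that at least one guard moves along the attacked edge from one endpoint to the other. The defender wins if every attack of any infinite sequence can be answered in this way. There are two versions of the game: in one, several guards may share a vertex; in the other, no configuration may have more than one guard on a vertex. Then $G$ has a minimum vertex cover of size $k$ that contains all cut vertices of $G$, so that $\operatorname{mvc}_X(G)=k$, and, in both versions of the game, $$\operatorname{evc}(G)=k+\left\lceil\frac{k+1}{2}\right\rceil .$$ Consequently $\operatorname{evc}(G)>1.5\,\operatorname{mvc}_X(G)$. -/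

import Mathlib

/-- `x` is a cut vertex of `G`: two vertices that are connected in `G` get disconnected
when `x` is deleted (that is, deleting `x` increases the number of components). -/
def IsCutVertex {V : Type*} (G : SimpleGraph V) (x : V) : Prop :=
  ∃ (u v : V) (hu : u ∈ ({x}ᶜ : Set V)) (hv : v ∈ ({x}ᶜ : Set V)),
    G.Reachable u v ∧ ¬ (G.induce ({x}ᶜ : Set V)).Reachable ⟨u, hu⟩ ⟨v, hv⟩

/-- The set `X` of all cut vertices of `G`. -/
def cutVertices {V : Type*} (G : SimpleGraph V) : Set V := {x | IsCutVertex G x}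

/-- A cactus: a connected graph in which any two distinct simple cycles have at most one
vertex in common. Two cycles are the same when they are the same subgraph. -/
def IsCactus {V : Type*} (G : SimpleGraph V) : Prop :=
  G.Connected ∧
    ∀ (u v : V) (c : G.Walk u u) (d : G.Walk v v), c.IsCycle → d.IsCycle →
      c.toSubgraph ≠ d.toSubgraph → (c.toSubgraph.verts ∩ d.toSubgraph.verts).Subsingleton

/-- `mvc_S(G)`: the minimum cardinality of a vertex cover of `G` that contains all of `S`. -/
noncomputable def mvcContaining {V : Type*} (G : SimpleGraph V) (S : Set V) : ℕ :=
  sInf {n | ∃ C : Finset V, G.IsVertexCover (C : Set V) ∧ S ⊆ (C : Set V) ∧ C.card = n}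

/-- `mvc_X(G)`, where `X` is the set of cut vertices of `G`. -/
noncomputable def mvcX {V : Type*} (G : SimpleGraph V) : ℕ :=
  mvcContaining G (cutVertices G)

/-- One round of the game with `n` guards, `c i` and `c' i` being the positions of guard `i`
before and after the round: every guard stays or moves to a neighbouring vertex, and some
guard moves along the attacked edge `e`, from one of its endpoints to the other. -/
def DefendsAttack {V : Type*} (G : SimpleGraph V) {n : ℕ} (c c' : Fin n → V)
    (e : G.edgeSet) : Prop :=
  (∀ i, c' i = c i ∨ G.Adj (c i) (c' i)) ∧ ∃ i, s(c i, c' i) = (e : Sym2 V)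

/-- A defense strategy with `n` guards: to each finite history of attacks (latest attack first)
it assigns the configuration after these attacks, `σ []` being the initial configuration, such
that every further attack is successfully defended. Several guards may share a vertex. -/
def IsDefenseStrategy {V : Type*} (G : SimpleGraph V) {n : ℕ}
    (σ : List G.edgeSet → Fin n → V) : Prop :=
  ∀ (h : List G.edgeSet) (e : G.edgeSet), DefendsAttack G (σ h) (σ (e :: h)) e

/-- The eternal vertex cover number: the least number of guards with a defense strategy. -/
noncomputable def evc {V : Type*} (G : SimpleGraph V) : ℕ :=
  sInf {n | ∃ σ : List G.edgeSet → Fin n → V, IsDefenseStrategy G σ}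

/-- The eternal vertex cover number in the version of the game in which no configuration
may have more than one guard on a vertex. -/
noncomputable def evcSingle {V : Type*} (G : SimpleGraph V) : ℕ :=
  sInf {n | ∃ σ : List G.edgeSet → Fin n → V,
    IsDefenseStrategy G σ ∧ ∀ h, Function.Injective (σ h)}

/-- The cycle on `n` vertices (for `3 ≤ n`) together with a pendent vertex for each `p : P`,
adjacent only to the cycle vertex `f p`. -/
def cycleWithPendents (n : ℕ) {P : Type*} (f : P → Fin n) : SimpleGraph (Fin n ⊕ P) where
  Adj
    | .inl a, .inl b => (SimpleGraph.cycleGraph n).Adj a b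
    | .inl a, .inr p => f p = a
    | .inr p, .inl a => f p = a
    | .inr _, .inr _ => False
  symm := ⟨by
    rintro (a | p) (b | q) h
    · exact SimpleGraph.Adj.symm h
    · exact h
    · exact h
    · exact h⟩
  loopless := ⟨by
    rintro (a | p) h
    · exact SimpleGraph.irrefl _ h
    · exact h⟩

/-!
Give each alternate vertex `x` of the cycle the window sum `2 * M x + M (x + 1) + M (x - 1)`, where
`M` counts the guards on a cycle vertex and on its pendent vertices. The window sums add up to
twice the number of guards.

For the lower bound, the threats on the edges at `x` force every window sum to be at least `3`, and
at least `4` if a pendent vertex of `x` is guarded. An attack on a pendent edge brings such a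
configuration about, so `2 * m > 3 * k` for `m` guards.

For the upper bound, the defender keeps a guard on every alternate vertex and one next to it. An
attack on the edge from `j` to an unguarded `y` starts a relay: the guard on `j` leaves for `y` and
a guard next to `j` on the other side relieves it. Where this deprives the alternate vertex behind
of its guarded neighbour, the next alternate guard that can be relieved advances to restore one, and
so on around the cycle. If the relay could never end, no pendent vertex would be guarded and no
alternate vertex would have guards on both sides, so every window sum would be at most `3`,
contradicting `2 * m > 3 * k`.
-/

section Game

variable {V : Type*} {G : SimpleGraph V}

theorem evc_eq {n : ℕ} {σ : List G.edgeSet → Fin n → V} (hσ : IsDefenseStrategy G σ)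
    (hmin : ∀ (m : ℕ) (τ : List G.edgeSet → Fin m → V), IsDefenseStrategy G τ → n ≤ m) :
    evc G = n :=
  le_antisymm (Nat.sInf_le ⟨σ, hσ⟩) (le_csInf ⟨n, σ, hσ⟩ fun m ⟨τ, hτ⟩ => hmin m τ hτ)

theorem evcSingle_eq {n : ℕ} {σ : List G.edgeSet → Fin n → V} (hσ : IsDefenseStrategy G σ)
    (hinj : ∀ h, Function.Injective (σ h))
    (hmin : ∀ (m : ℕ) (τ : List G.edgeSet → Fin m → V), IsDefenseStrategy G τ → n ≤ m) :
    evcSingle G = n :=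
  le_antisymm (Nat.sInf_le ⟨σ, hσ, hinj⟩)
    (le_csInf ⟨n, σ, hσ, hinj⟩ fun m ⟨τ, hτ, _⟩ => hmin m τ hτ)

namespace IsDefenseStrategy

variable {n : ℕ} {σ : List G.edgeSet → Fin n → V}

theorem exists_guard_of_adj (hσ : IsDefenseStrategy G σ) (h : List G.edgeSet) {u v : V}
    (huv : G.Adj u v) : ∃ i, σ h i = u ∨ σ h i = v := by
  obtain ⟨-, i, hi⟩ := hσ h ⟨s(u, v), huv⟩
  rcases Sym2.eq_iff.1 hi with ⟨hu, -⟩ | ⟨hv, -⟩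
  exacts [⟨i, Or.inl hu⟩, ⟨i, Or.inr hv⟩]

theorem exists_history_guard_eq (hσ : IsDefenseStrategy G σ) {u v : V} (huv : G.Adj u v) :
    ∃ h i, σ h i = v := by
  obtain ⟨-, i, hi⟩ := hσ [] ⟨s(u, v), huv⟩
  rcases Sym2.eq_iff.1 hi with ⟨-, hv⟩ | ⟨hv, -⟩
  exacts [⟨_, i, hv⟩, ⟨_, i, hv⟩]

/- If the attack on `xy` is answered from `y`, the responder is the second guard. If it is answered
from `x`, then afterwards some guard covers `xp`, and that guard was next to `x` before. -/
theorem exists_two_guards_near (hσ : IsDefenseStrategy G σ) (h : List G.edgeSet) {x y p : V}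
    (hxp : G.Adj x p) (hp : ∀ w, G.Adj p w → w = x) (hxy : G.Adj x y) (hyp : y ≠ p) :
    ∃ i j, i ≠ j ∧ (σ h i = x ∨ σ h i = p) ∧ (σ h j = x ∨ G.Adj x (σ h j)) := by
  let e : G.edgeSet := ⟨s(x, y), hxy⟩
  obtain ⟨hmove, r, hr⟩ := hσ h e
  rcases Sym2.eq_iff.1 hr with ⟨hrx, hry⟩ | ⟨hry, -⟩
  · obtain ⟨j, hj⟩ := hσ.exists_guard_of_adj (e :: h) hxp
    have hrj : r ≠ j := by
      rintro rfl
      rcases hj with hj | hj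
      exacts [hxy.ne (hj.symm.trans hry), hyp (hry.symm.trans hj)]
    refine ⟨r, j, hrj, Or.inl hrx, ?_⟩
    rcases hmove j with hstay | hadj <;> rcases hj with hj | hj
    · exact Or.inl (hstay.symm.trans hj)
    · exact Or.inr (hstay ▸ hj ▸ hxp)
    · exact Or.inr (hj ▸ hadj.symm)
    · exact Or.inl (hp _ (hj ▸ hadj.symm))
  · obtain ⟨i, hi⟩ := hσ.exists_guard_of_adj h hxp
    refine ⟨i, r, ?_, hi, Or.inr (hry ▸ hxy)⟩
    rintro rfl
    rcases hi with hi | hi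
    exacts [hxy.ne (hi.symm.trans hry), hyp (hry.symm.trans hi)]

end IsDefenseStrategy

/-- A move `g` of single guards on the vertices of `S` answering an attack on the edge `e`:
the guard on `v` goes to `g v`. -/
structure IsDefensiveMove (G : SimpleGraph V) (S : Set V) (e : Sym2 V) (g : V → V) : Prop where
  injOn : Set.InjOn g S
  eq_or_adj : ∀ v ∈ S, g v = v ∨ G.Adj v (g v)
  exists_eq : ∃ v ∈ S, s(v, g v) = e

theorem exists_injective_strategy (I : Set V → Prop)
    (hI : ∀ S, I S → ∀ e ∈ G.edgeSet, ∃ g, IsDefensiveMove G S e g ∧ I (g '' S))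
    (S₀ : Finset V) (hS₀ : I S₀) :
    ∃ σ : List G.edgeSet → Fin S₀.card → V,
      IsDefenseStrategy G σ ∧ ∀ h, Function.Injective (σ h) := by
  let C := {c : Fin S₀.card → V // Function.Injective c ∧ I (Set.range c)}
  have step : ∀ (c : C) (e : G.edgeSet), ∃ c' : C, DefendsAttack G c.1 c'.1 e := by
    rintro ⟨c, hc, hcI⟩ e
    obtain ⟨g, hg, hgI⟩ := hI _ hcI e e.2
    obtain ⟨_, ⟨i, rfl⟩, hi⟩ := hg.exists_eq
    exact ⟨⟨g ∘ c, fun _ _ h => hc (hg.injOn ⟨_, rfl⟩ ⟨_, rfl⟩ h), by rwa [Set.range_comp]⟩,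
      fun i => hg.eq_or_adj _ ⟨i, rfl⟩, i, hi⟩
  choose next hnext using step
  have hrange : Set.range (fun i => (S₀.equivFin.symm i : V)) = S₀ := by
    rw [← Function.comp_def, S₀.equivFin.symm.surjective.range_comp]
    exact Subtype.range_coe
  let c₀ : C := ⟨fun i => S₀.equivFin.symm i,
    Subtype.val_injective.comp S₀.equivFin.symm.injective, by rwa [hrange]⟩
  let τ : List G.edgeSet → C := fun h => h.foldr (fun e c => next c e) c₀
  exact ⟨fun h => (τ h).1, fun h e => hnext (τ h) e, fun h => (τ h).2.1⟩

theorem isDefensiveMove_swap [DecidableEq V] {S : Set V} {u v : V} (huv : G.Adj u v) (hu : u ∈ S) :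
    IsDefensiveMove G S s(u, v) (Equiv.swap u v) where
  injOn := (Equiv.swap u v).injective.injOn
  eq_or_adj w _ := by
    rcases eq_or_ne w u with rfl | hwu
    · exact Or.inr (by rwa [Equiv.swap_apply_left])
    rcases eq_or_ne w v with rfl | hwv
    · exact Or.inr (by rw [Equiv.swap_apply_right]; exact huv.symm)
    · exact Or.inl (Equiv.swap_apply_of_ne_of_ne hwu hwv)
  exists_eq := ⟨u, hu, by rw [Equiv.swap_apply_left]⟩

variable {ι : Type*}

/-- The data of a simultaneous move of guards on `S`, one step for each `x ∈ A`: the guard on the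
base `b x` leaves for the target `o x` and is replaced by the guard on the source `i x`. -/
structure IsRelay (G : SimpleGraph V) (S : Set V) (A : Set ι) (b i o : ι → V) : Prop where
  base_injOn : Set.InjOn b A
  source_injOn : Set.InjOn i A
  target_injOn : Set.InjOn o A
  base_mem : ∀ x ∈ A, b x ∈ S
  source_mem : ∀ x ∈ A, i x ∈ S
  source_ne_base : ∀ x ∈ A, ∀ y ∈ A, i x ≠ b y
  adj_source : ∀ x ∈ A, G.Adj (b x) (i x)
  adj_target : ∀ x ∈ A, G.Adj (b x) (o x)
  target_vacated : ∀ x ∈ A, o x ∈ S → ∃ y ∈ A, i y = o x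

/-- The map sending bases to targets and sources to bases, and fixing all other vertices. -/
noncomputable def relayMove (A : Set ι) (b i o : ι → V) : V → V :=
  Function.extend (fun x : A => b x) (fun x => o x)
    (Function.extend (fun x : A => i x) (fun x => b x) id)

namespace IsRelay

variable {S : Set V} {A : Set ι} {b i o : ι → V} {x : ι}

theorem relayMove_base (hR : IsRelay G S A b i o) (hx : x ∈ A) :
    relayMove A b i o (b x) = o x :=
  hR.base_injOn.injective.extend_apply _ _ (⟨x, hx⟩ : A)

theorem relayMove_source (hR : IsRelay G S A b i o) (hx : x ∈ A) :
    relayMove A b i o (i x) = b x := by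
  rw [relayMove, Function.extend_apply' _ _ _ fun ⟨y, hy⟩ =>
    hR.source_ne_base x hx _ y.2 hy.symm]
  exact hR.source_injOn.injective.extend_apply _ _ (⟨x, hx⟩ : A)

theorem relayMove_of_forall_ne {v : V} (hb : ∀ x ∈ A, b x ≠ v) (hi : ∀ x ∈ A, i x ≠ v) :
    relayMove A b i o v = v := by
  rw [relayMove, Function.extend_apply' _ _ _ fun ⟨y, hy⟩ => hb _ y.2 hy,
    Function.extend_apply' _ _ _ fun ⟨y, hy⟩ => hi _ y.2 hy, id]

theorem base_or_source_or_fixed (A : Set ι) (b i o : ι → V) (v : V) :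
    (∃ x ∈ A, b x = v) ∨ (∃ x ∈ A, i x = v) ∨
      (∀ x ∈ A, b x ≠ v) ∧ (∀ x ∈ A, i x ≠ v) ∧ relayMove A b i o v = v := by
  by_cases hb : ∃ x ∈ A, b x = v
  · exact Or.inl hb
  by_cases hi : ∃ x ∈ A, i x = v
  · exact Or.inr (Or.inl hi)
  push Not at hb hi
  exact Or.inr (Or.inr ⟨hb, hi, relayMove_of_forall_ne hb hi⟩)

theorem target_ne_base (hR : IsRelay G S A b i o) (hx : x ∈ A) : ∀ y ∈ A, o x ≠ b y := by
  intro y hy h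
  obtain ⟨z, hz, hzx⟩ := hR.target_vacated x hx (h ▸ hR.base_mem y hy)
  exact hR.source_ne_base z hz y hy (hzx.trans h)

theorem target_ne_of_mem (hR : IsRelay G S A b i o) (hx : x ∈ A) {v : V} (hv : v ∈ S)
    (hi : ∀ y ∈ A, i y ≠ v) : o x ≠ v := by
  rintro rfl
  obtain ⟨y, hy, hyx⟩ := hR.target_vacated x hx hv
  exact hi y hy hyx

theorem relayMove_injOn (hR : IsRelay G S A b i o) : Set.InjOn (relayMove A b i o) S := by
  intro v hv w hw hvw
  rcases base_or_source_or_fixed A b i o v with ⟨x, hx, rfl⟩ | ⟨x, hx, rfl⟩ | ⟨hvb, hvi, hvf⟩ <;>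
  rcases base_or_source_or_fixed A b i o w with ⟨y, hy, rfl⟩ | ⟨y, hy, rfl⟩ | ⟨hwb, hwi, hwf⟩
  · rw [hR.relayMove_base hx, hR.relayMove_base hy] at hvw
    rw [hR.target_injOn hx hy hvw]
  · rw [hR.relayMove_base hx, hR.relayMove_source hy] at hvw
    exact absurd hvw (hR.target_ne_base hx y hy)
  · rw [hR.relayMove_base hx, hwf] at hvw
    exact absurd hvw (hR.target_ne_of_mem hx hw hwi)
  · rw [hR.relayMove_source hx, hR.relayMove_base hy] at hvw
    exact absurd hvw.symm (hR.target_ne_base hy x hx)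
  · rw [hR.relayMove_source hx, hR.relayMove_source hy] at hvw
    rw [hR.base_injOn hx hy hvw]
  · rw [hR.relayMove_source hx, hwf] at hvw
    exact absurd hvw (hwb x hx)
  · rw [hvf, hR.relayMove_base hy] at hvw
    exact absurd hvw.symm (hR.target_ne_of_mem hy hv hvi)
  · rw [hvf, hR.relayMove_source hy] at hvw
    exact absurd hvw.symm (hvb y hy)
  · rwa [hvf, hwf] at hvw

theorem isDefensiveMove (hR : IsRelay G S A b i o) (hx : x ∈ A) :
    IsDefensiveMove G S s(b x, o x) (relayMove A b i o) where
  injOn := hR.relayMove_injOn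
  eq_or_adj v _ := by
    rcases base_or_source_or_fixed A b i o v with ⟨y, hy, rfl⟩ | ⟨y, hy, rfl⟩ | ⟨-, -, hv⟩
    · exact Or.inr (hR.relayMove_base hy ▸ hR.adj_target y hy)
    · exact Or.inr (hR.relayMove_source hy ▸ (hR.adj_source y hy).symm)
    · exact Or.inl hv
  exists_eq := ⟨b x, hR.base_mem x hx, by rw [hR.relayMove_base hx]⟩

theorem image_relayMove (hR : IsRelay G S A b i o) :
    relayMove A b i o '' S = (S \ i '' A) ∪ o '' A := by
  ext v
  constructor
  · rintro ⟨u, hu, rfl⟩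
    rcases base_or_source_or_fixed A b i o u with ⟨x, hx, rfl⟩ | ⟨x, hx, rfl⟩ | ⟨-, hi, hf⟩
    · exact Or.inr ⟨x, hx, (hR.relayMove_base hx).symm⟩
    · rw [hR.relayMove_source hx]
      exact Or.inl ⟨hR.base_mem x hx, fun ⟨y, hy, hyx⟩ => hR.source_ne_base y hy x hx hyx⟩
    · rw [hf]
      exact Or.inl ⟨hu, fun ⟨y, hy, hyu⟩ => hi y hy hyu⟩
  · rintro (⟨hv, hi⟩ | ⟨x, hx, rfl⟩)
    · rcases base_or_source_or_fixed A b i o v with ⟨x, hx, rfl⟩ | ⟨x, hx, rfl⟩ | ⟨-, -, hf⟩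
      · exact ⟨i x, hR.source_mem x hx, hR.relayMove_source hx⟩
      · exact absurd ⟨x, hx, rfl⟩ hi
      · exact ⟨v, hv, hf⟩
    · exact ⟨b x, hR.base_mem x hx, hR.relayMove_base hx⟩

end IsRelay

/-- Guards on `S` reinforce `B` if each vertex of `B` carries a guard and has a guarded
neighbour, which can take over when the guard on the vertex is called away. -/
structure Reinforces (G : SimpleGraph V) (S B : Set V) : Prop where
  subset : B ⊆ S
  exists_adj : ∀ b ∈ B, ∃ w ∈ S, G.Adj b w

theorem IsRelay.reinforces {S B : Set V} {A : Set ι} {b i o : ι → V} (hR : IsRelay G S A b i o)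
    (hB : B ⊆ S) (hiB : ∀ x ∈ A, i x ∉ B)
    (hidle : ∀ v ∈ B, (∀ x ∈ A, b x ≠ v) → ∃ w ∈ (S \ i '' A) ∪ o '' A, G.Adj v w) :
    Reinforces G (relayMove A b i o '' S) B := by
  rw [hR.image_relayMove]
  refine ⟨fun v hv => Or.inl ⟨hB hv, fun ⟨x, hx, h⟩ => hiB x hx (h ▸ hv)⟩, fun v hv => ?_⟩
  by_cases hact : ∃ x ∈ A, b x = v
  · obtain ⟨x, hx, rfl⟩ := hact
    exact ⟨o x, Or.inr ⟨x, hx, rfl⟩, hR.adj_target x hx⟩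
  · push Not at hact
    exact hidle v hv hact

end Game

section Graph

variable {V : Type*} {G : SimpleGraph V}

theorem reachable_induce_compl_singleton_of_walk {x u v : V}
    (hx : ∀ u v (hu : G.Adj x u) (hv : G.Adj x v),
      (G.induce ({x}ᶜ : Set V)).Reachable ⟨u, hu.ne'⟩ ⟨v, hv.ne'⟩) (hv : v ≠ x) (p : G.Walk u v) :
    (∀ hu : u ≠ x, (G.induce ({x}ᶜ : Set V)).Reachable ⟨u, hu⟩ ⟨v, hv⟩) ∧
      (u = x → ∀ w (hw : G.Adj x w), (G.induce ({x}ᶜ : Set V)).Reachable ⟨w, hw.ne'⟩ ⟨v, hv⟩) := by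
  induction p with
  | nil => exact ⟨fun _ => .rfl, fun hux => absurd hux hv⟩
  | @cons u m v hum _ ih =>
    obtain ⟨ih_ne, ih_eq⟩ := ih hv
    refine ⟨fun hu => ?_, ?_⟩
    · by_cases hm : m = x
      · exact ih_eq hm u (hm ▸ hum.symm)
      · exact SimpleGraph.Reachable.trans
          (SimpleGraph.Adj.reachable (SimpleGraph.induce_adj.2 hum)) (ih_ne hm)
    · rintro rfl w hw
      exact (hx w m hw hum).trans (ih_ne hum.ne')

theorem not_isCutVertex_of_forall_adj_reachable {x : V}
    (hx : ∀ u v (hu : G.Adj x u) (hv : G.Adj x v),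
      (G.induce ({x}ᶜ : Set V)).Reachable ⟨u, hu.ne'⟩ ⟨v, hv.ne'⟩) :
    ¬ IsCutVertex G x := by
  rintro ⟨u, v, hu, hv, ⟨p⟩, hsep⟩
  exact hsep ((reachable_induce_compl_singleton_of_walk hx hv p).1 hu)

theorem notMem_verts_toSubgraph_of_isCycle {u p x : V} {c : G.Walk u u} (hc : c.IsCycle)
    (hp : ∀ w, G.Adj p w → w = x) : p ∉ c.toSubgraph.verts := by
  intro hpc
  have htwo := hc.ncard_neighborSet_toSubgraph_eq_two
    ((SimpleGraph.Walk.mem_verts_toSubgraph c).1 hpc)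
  have hone : (c.toSubgraph.neighborSet p).ncard ≤ ({x} : Set V).ncard :=
    Set.ncard_le_ncard fun w hw => hp w (c.toSubgraph.adj_sub hw)
  rw [htwo, Set.ncard_singleton] at hone
  omega

end Graph

section CycleWithPendents

variable {n : ℕ} {P : Type*} {f : P → Fin n}

/-- The cycle vertex a vertex of `cycleWithPendents n f` sits on: itself for a cycle vertex,
its neighbour for a pendent vertex. -/
def foot (f : P → Fin n) : Fin n ⊕ P → Fin n := Sum.elim id f

theorem adj_inl_inr {a : Fin n} {p : P} :
    (cycleWithPendents n f).Adj (Sum.inl a) (Sum.inr p) ↔ f p = a := Iff.rfl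

theorem eq_inl_of_adj_inr {p : P} :
    ∀ w, (cycleWithPendents n f).Adj (Sum.inr p) w → w = Sum.inl (f p)
  | .inl _, h => congrArg Sum.inl (Eq.symm h)

theorem ncard_range_le_card_of_isVertexCover {D : Finset (Fin n ⊕ P)}
    (hD : (cycleWithPendents n f).IsVertexCover (D : Set (Fin n ⊕ P))) :
    (Set.range f).ncard ≤ D.card := by
  have hsub : Set.range f ⊆ foot f '' (D : Set (Fin n ⊕ P)) := by
    rintro _ ⟨p, rfl⟩
    rcases hD (adj_inl_inr.2 (rfl : f p = f p)) with h | h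
    exacts [⟨_, h, rfl⟩, ⟨_, h, rfl⟩]
  calc (Set.range f).ncard ≤ (foot f '' (D : Set (Fin n ⊕ P))).ncard := Set.ncard_le_ncard hsub
    _ ≤ (D : Set (Fin n ⊕ P)).ncard := Set.ncard_image_le D.finite_toSet
    _ = D.card := Set.ncard_coe_finset D

theorem not_isCutVertex_inr (p : P) : ¬ IsCutVertex (cycleWithPendents n f) (Sum.inr p) :=
  not_isCutVertex_of_forall_adj_reachable fun u v hu hv => by
    obtain rfl := eq_inl_of_adj_inr u hu
    obtain rfl := eq_inl_of_adj_inr v hv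
    rfl

variable [NeZero n]

theorem mem_of_forall_add_mem {d : Fin n} (hd : d = 1 ∨ d = -1) {C : Set (Fin n)}
    (hC : C.Nonempty) (hadd : ∀ a ∈ C, a + d ∈ C) (a : Fin n) : a ∈ C := by
  have one_case : ∀ {C : Set (Fin n)}, C.Nonempty → (∀ a ∈ C, a + 1 ∈ C) → ∀ a, a ∈ C := by
    rintro C ⟨c, hc⟩ hadd a
    have hmem : ∀ m : ℕ, c + Fin.ofNat n m ∈ C := by
      intro m
      induction m with
      | zero => simpa using hc
      | succ m ih =>
        have hsucc : Fin.ofNat n (m + 1) = Fin.ofNat n m + 1 := by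
          simp [Fin.ext_iff, Fin.val_add]
        rw [hsucc, ← add_assoc]
        exact hadd _ ih
    have h := hmem (a - c).val
    rwa [Fin.ofNat_val_eq_self, add_sub_cancel] at h
  rcases hd with rfl | rfl
  · exact one_case hC hadd a
  · obtain ⟨c, hc⟩ := hC
    have h : -a ∈ {b | -b ∈ C} := by
      refine one_case ⟨-c, by simpa using hc⟩ (fun b hb => ?_) _
      simpa [add_comm] using hadd _ hb
    simpa using h

theorem adj_inl_inl (hn : 2 ≤ n) {a b : Fin n} :
    (cycleWithPendents n f).Adj (Sum.inl a) (Sum.inl b) ↔ b = a + 1 ∨ b = a - 1 := by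
  have val_eq_one : ∀ x : Fin n, x.val = 1 ↔ x = 1 := fun x => by
    rw [Fin.ext_iff, Fin.val_one', Nat.mod_eq_of_lt (by omega)]
  change (SimpleGraph.cycleGraph n).Adj a b ↔ _
  rw [SimpleGraph.cycleGraph_adj', val_eq_one, val_eq_one, or_comm, sub_eq_iff_eq_add',
    sub_eq_iff_eq_add', eq_sub_iff_add_eq, eq_comm (a := a), add_comm a]

theorem cycleWithPendents_connected (f : P → Fin n) : (cycleWithPendents n f).Connected := by
  let cycle : SimpleGraph.cycleGraph n →g cycleWithPendents n f := ⟨Sum.inl, fun h => h⟩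
  have to_foot : ∀ v, (cycleWithPendents n f).Reachable v (Sum.inl (foot f v)) := by
    rintro (a | p)
    exacts [.rfl, (adj_inl_inr.2 rfl).symm.reachable]
  have : Nonempty (Fin n ⊕ P) := ⟨Sum.inl 0⟩
  exact ⟨fun u v => (to_foot u).trans
    (((SimpleGraph.cycleGraph_preconnected _ _).map cycle).trans (to_foot v).symm)⟩

section IsCycle

variable {u : Fin n ⊕ P} {c : (cycleWithPendents n f).Walk u u}

theorem neighborSet_toSubgraph_of_isCycle (hn : 2 ≤ n) (hc : c.IsCycle) {a : Fin n}
    (ha : Sum.inl a ∈ c.toSubgraph.verts) :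
    c.toSubgraph.neighborSet (Sum.inl a) = {Sum.inl (a + 1), Sum.inl (a - 1)} := by
  refine Set.eq_of_subset_of_ncard_le ?_ ?_
  · rintro (b | q) h
    · rcases (adj_inl_inl hn).1 (c.toSubgraph.adj_sub h) with rfl | rfl
      exacts [Or.inl rfl, Or.inr rfl]
    · exact absurd (c.toSubgraph.edge_vert h.symm)
        (notMem_verts_toSubgraph_of_isCycle hc eq_inl_of_adj_inr)
  · rw [hc.ncard_neighborSet_toSubgraph_eq_two ((SimpleGraph.Walk.mem_verts_toSubgraph c).1 ha)]
    exact (Set.ncard_insert_le _ _).trans (by rw [Set.ncard_singleton])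

theorem toSubgraph_eq_of_isCycle (hn : 2 ≤ n) (hc : c.IsCycle) :
    c.toSubgraph = (⊤ : (cycleWithPendents n f).Subgraph).induce (Set.range Sum.inl) := by
  have no_pendent : ∀ p, Sum.inr p ∉ c.toSubgraph.verts := fun p =>
    notMem_verts_toSubgraph_of_isCycle hc eq_inl_of_adj_inr
  have nbr : ∀ {a}, Sum.inl a ∈ c.toSubgraph.verts → ∀ w,
      c.toSubgraph.Adj (Sum.inl a) w ↔ w = Sum.inl (a + 1) ∨ w = Sum.inl (a - 1) := fun ha w =>
    Set.ext_iff.1 (neighborSet_toSubgraph_of_isCycle hn hc ha) w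
  have nonempty : {a | Sum.inl a ∈ c.toSubgraph.verts}.Nonempty := by
    have hu : u ∈ c.toSubgraph.verts := c.start_mem_verts_toSubgraph
    rcases u with a | p
    exacts [⟨a, hu⟩, absurd hu (no_pendent p)]
  have all : ∀ a, Sum.inl a ∈ c.toSubgraph.verts :=
    mem_of_forall_add_mem (Or.inl rfl) nonempty fun a ha =>
      c.toSubgraph.edge_vert ((nbr ha _).2 (Or.inl rfl)).symm
  refine SimpleGraph.Subgraph.ext ?_ ?_
  · ext (a | p)
    · exact iff_of_true (all a) ⟨a, rfl⟩
    · exact iff_of_false (no_pendent p) (by rintro ⟨a, ⟨⟩⟩)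
  · ext (a | p) w
    · rw [nbr (all a)]
      rcases w with b | q
      · simp [adj_inl_inl hn]
      · simp
    · exact iff_of_false (fun h => no_pendent p (c.toSubgraph.edge_vert h)) (by simp)

end IsCycle

theorem isCactus_cycleWithPendents (hn : 2 ≤ n) (f : P → Fin n) :
    IsCactus (cycleWithPendents n f) :=
  ⟨cycleWithPendents_connected f, fun _ _ _ _ hc hd hne =>
    absurd ((toSubgraph_eq_of_isCycle hn hc).trans (toSubgraph_eq_of_isCycle hn hd).symm) hne⟩

theorem not_isCutVertex_inl (hn : 2 ≤ n) {w : Fin n} (hw : w ∉ Set.range f) :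
    ¬ IsCutVertex (cycleWithPendents n f) (Sum.inl w) := by
  have hadj {a : Fin n} : (cycleWithPendents n f).Adj (Sum.inl a) (Sum.inl (a + 1)) :=
    (adj_inl_inl hn).2 (Or.inl rfl)
  have hadj' : (cycleWithPendents n f).Adj (Sum.inl w) (Sum.inl (w - 1)) :=
    (adj_inl_inl hn).2 (Or.inr rfl)
  have detour : ((cycleWithPendents n f).induce ({Sum.inl w}ᶜ : Set (Fin n ⊕ P))).Reachable
      ⟨Sum.inl (w + 1), hadj.ne'⟩ ⟨Sum.inl (w - 1), hadj'.ne'⟩ := by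
    by_contra hsep
    let C : Set (Fin n) := {a | ∃ ha : (Sum.inl a : Fin n ⊕ P) ≠ Sum.inl w,
      ((cycleWithPendents n f).induce ({Sum.inl w}ᶜ : Set (Fin n ⊕ P))).Reachable
        ⟨Sum.inl (w + 1), hadj.ne'⟩ ⟨Sum.inl a, ha⟩}
    have hC : ∀ a ∈ C, a + 1 ∈ C := by
      rintro a ⟨ha, hreach⟩
      have hne : a + 1 ≠ w := by
        rintro rfl
        exact hsep (by simpa using hreach)
      exact ⟨fun h => hne (Sum.inl_injective h),
        hreach.trans (SimpleGraph.Adj.reachable (SimpleGraph.induce_adj.2 hadj))⟩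
    obtain ⟨hne, -⟩ := mem_of_forall_add_mem (Or.inl rfl)
      (show C.Nonempty from ⟨w + 1, hadj.ne', .rfl⟩) hC w
    exact hne rfl
  refine not_isCutVertex_of_forall_adj_reachable ?_
  rintro (a | p) (b | q) ha hb
  · rcases (adj_inl_inl hn).1 ha with rfl | rfl <;> rcases (adj_inl_inl hn).1 hb with rfl | rfl
    exacts [.rfl, detour, detour.symm, .rfl]
  · exact absurd ⟨q, hb⟩ hw
  · exact absurd ⟨p, ha⟩ hw
  · exact absurd ⟨p, ha⟩ hw

theorem cutVertices_cycleWithPendents_subset (hn : 2 ≤ n) (f : P → Fin n) :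
    cutVertices (cycleWithPendents n f) ⊆ Sum.inl '' Set.range f := by
  rintro (w | p) hv
  · by_contra hw
    exact not_isCutVertex_inl hn (fun h => hw ⟨w, h, rfl⟩) hv
  · exact absurd hv (not_isCutVertex_inr p)

end CycleWithPendents

section AlternateVertices

theorem two_le_two_mul (k : ℕ) [NeZero k] : 2 ≤ 2 * k := Nat.le_mul_of_pos_right 2 (NeZero.pos k)

/-- The alternate vertices `v₀, v₂, …` of the cycle on `2 * k` vertices. -/
def evens (k : ℕ) : Finset (Fin (2 * k)) := {a | Even a.val}

theorem mem_evens {k : ℕ} {a : Fin (2 * k)} : a ∈ evens k ↔ Even a.val := by simp [evens]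

/-- The alternate vertices as vertices of `cycleWithPendents (2 * k) f`, where the cycle vertices
are on the left. -/
def alternateVertices (k : ℕ) (P : Type*) : Finset (Fin (2 * k) ⊕ P) :=
  (evens k).map Function.Embedding.inl

theorem inl_mem_alternateVertices {k : ℕ} {P : Type*} {a : Fin (2 * k)} :
    Sum.inl a ∈ alternateVertices k P ↔ a ∈ evens k := by
  simp [alternateVertices]

theorem forall_mem_alternateVertices {k : ℕ} {P : Type*} {p : Fin (2 * k) ⊕ P → Prop} :
    (∀ v ∈ alternateVertices k P, p v) ↔ ∀ a ∈ evens k, p (Sum.inl a) := by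
  simp [alternateVertices]

variable {k : ℕ} [NeZero k] {a d : Fin (2 * k)}

theorem zero_mem_evens : (0 : Fin (2 * k)) ∈ evens k := by simp [mem_evens]

theorem add_mem_evens (hd : d = 1 ∨ d = -1) : a + d ∈ evens k ↔ a ∉ evens k := by
  have add_one (a : Fin (2 * k)) : a + 1 ∈ evens k ↔ a ∉ evens k := by
    rw [mem_evens, mem_evens, Fin.val_add, Fin.val_one', Nat.add_mod_mod, Nat.even_iff,
      Nat.even_iff, Nat.mod_mod_of_dvd _ (Dvd.intro _ rfl)]
    omega
  rcases hd with rfl | rfl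
  · exact add_one a
  · rw [← not_iff_not, not_not, ← add_one, neg_add_cancel_right]

theorem neg_eq_one_or (hd : d = 1 ∨ d = -1) : -d = 1 ∨ -d = -1 := by
  rcases hd with rfl | rfl <;> simp

theorem sub_mem_evens (hd : d = 1 ∨ d = -1) : a - d ∈ evens k ↔ a ∉ evens k := by
  rw [sub_eq_add_neg, add_mem_evens (neg_eq_one_or hd)]

theorem sum_evens_add (hd : d = 1 ∨ d = -1) (M : Fin (2 * k) → ℕ) :
    ∑ x ∈ evens k, M (x + d) = ∑ x ∈ (evens k)ᶜ, M x :=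
  Finset.sum_equiv (Equiv.addRight d) (fun x => by simp [add_mem_evens hd]) fun _ _ => rfl

theorem sum_evens_window (M : Fin (2 * k) → ℕ) :
    ∑ x ∈ evens k, (2 * M x + M (x + 1) + M (x - 1)) = 2 * ∑ x, M x := by
  simp only [sub_eq_add_neg, Finset.sum_add_distrib, ← Finset.mul_sum,
    sum_evens_add (Or.inl rfl), sum_evens_add (Or.inr rfl)]
  rw [← Finset.sum_add_sum_compl (evens k) M]
  ring

theorem card_evens (k : ℕ) [NeZero k] : (evens k).card = k := by
  have h := sum_evens_window (k := k) fun _ => 1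
  simp only [Finset.sum_const, Finset.card_univ, Fintype.card_fin, smul_eq_mul] at h
  omega

theorem card_alternateVertices (k : ℕ) [NeZero k] (P : Type*) :
    (alternateVertices k P).card = k := by
  rw [alternateVertices, Finset.card_map, card_evens]

theorem mem_of_forall_add_add_mem (hd : d = 1 ∨ d = -1) {C : Set (Fin (2 * k))}
    {j x : Fin (2 * k)} (hj : j ∈ evens k) (hjC : j ∈ C)
    (hadd : ∀ x ∈ C, x + d + d ∈ C) (hx : x ∈ evens k) : x ∈ C := by
  let C' : Set (Fin (2 * k)) := {a | (a ∈ evens k → a ∈ C) ∧ (a ∉ evens k → a + d ∈ C)}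
  have hC' : ∀ a ∈ C', a + d ∈ C' := fun a ⟨heven, hodd⟩ =>
    ⟨fun h => hodd ((add_mem_evens hd).1 h),
      fun h => hadd a (heven (not_not.1 fun h' => h ((add_mem_evens hd).2 h')))⟩
  exact (mem_of_forall_add_mem hd (show C'.Nonempty from ⟨j, fun _ => hjC, absurd hj⟩) hC' x).1 hx

theorem exists_surplus {P : Type*} {S : Set (Fin (2 * k) ⊕ P)} (hS : 3 * k < 2 * S.ncard) :
    (∃ p, Sum.inr p ∈ S) ∨ ∃ x ∈ evens k, Sum.inl (x + 1) ∈ S ∧ Sum.inl (x - 1) ∈ S := by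
  classical
  by_contra! hno
  obtain ⟨no_pendent, not_both⟩ := hno
  let M : Fin (2 * k) → ℕ := fun a => if Sum.inl a ∈ S then 1 else 0
  have hcard : S.ncard = ∑ a, M a := by
    have himage : S = Sum.inl '' ↑(Finset.univ.filter fun a : Fin (2 * k) => Sum.inl a ∈ S) := by
      ext (a | p) <;> simp [no_pendent]
    rw [himage, Set.ncard_image_of_injective _ Sum.inl_injective, Set.ncard_coe_finset,
      Finset.card_filter]
  have window : ∀ x ∈ evens k, 2 * M x + M (x + 1) + M (x - 1) ≤ 3 := by
    intro x hx
    have hM : ∀ a, M a ≤ 1 := fun a => by simp only [M]; split_ifs <;> omega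
    have hboth : M (x + 1) = 0 ∨ M (x - 1) = 0 := by
      by_cases h : Sum.inl (x + 1) ∈ S
      · exact Or.inr (if_neg (not_both x hx h))
      · exact Or.inl (if_neg h)
    have := hM x
    have := hM (x + 1)
    have := hM (x - 1)
    omega
  have := Finset.sum_le_card_nsmul _ _ _ window
  rw [sum_evens_window, card_evens, ← hcard, smul_eq_mul] at this
  omega

end AlternateVertices

section LowerBound

/-- The number of guards on the cycle vertex `a` and on its pendent vertices. -/
def guardCount {n m : ℕ} {P : Type*} (f : P → Fin n) (c : Fin m → Fin n ⊕ P) (a : Fin n) : ℕ :=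
  (Finset.univ.filter fun i => foot f (c i) = a).card

section

variable {n m : ℕ} {P : Type*} {f : P → Fin n} {c : Fin m → Fin n ⊕ P} {a : Fin n} {i j : Fin m}

theorem sum_guardCount (f : P → Fin n) (c : Fin m → Fin n ⊕ P) : ∑ a, guardCount f c a = m := by
  have h := Finset.card_eq_sum_card_fiberwise (s := Finset.univ) (t := Finset.univ)
    (f := fun i => foot f (c i)) fun _ _ => Finset.mem_coe.2 (Finset.mem_univ _)
  rw [Finset.card_univ, Fintype.card_fin] at h
  exact h.symm

theorem one_le_guardCount (hi : foot f (c i) = a) : 1 ≤ guardCount f c a :=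
  Finset.card_pos.2 ⟨i, by simpa using hi⟩

theorem two_le_guardCount (hij : i ≠ j) (hi : foot f (c i) = a) (hj : foot f (c j) = a) :
    2 ≤ guardCount f c a :=
  Finset.one_lt_card.2 ⟨i, by simpa using hi, j, by simpa using hj, hij⟩

variable [NeZero n]

theorem foot_of_eq_or_adj (hn : 2 ≤ n) {v : Fin n ⊕ P}
    (hv : v = Sum.inl a ∨ (cycleWithPendents n f).Adj (Sum.inl a) v) :
    foot f v = a ∨ foot f v = a + 1 ∨ foot f v = a - 1 := by
  rcases hv with rfl | hv
  · exact Or.inl rfl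
  rcases v with b | p
  · exact Or.inr ((adj_inl_inl hn).1 hv)
  · exact Or.inl hv

variable {σ : List (cycleWithPendents n f).edgeSet → Fin m → Fin n ⊕ P}

theorem IsDefenseStrategy.three_le_guardCount_window
    (hσ : IsDefenseStrategy (cycleWithPendents n f) σ) (hn : 2 ≤ n)
    (h : List (cycleWithPendents n f).edgeSet) {x : Fin n} (hx : x ∈ Set.range f) :
    3 ≤ 2 * guardCount f (σ h) x + guardCount f (σ h) (x + 1) + guardCount f (σ h) (x - 1) := by
  obtain ⟨p, rfl⟩ := hx
  obtain ⟨i, j, hij, hi, hj⟩ := hσ.exists_two_guards_near h (adj_inl_inr.2 rfl) eq_inl_of_adj_inr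
    ((adj_inl_inl hn).2 (Or.inl rfl)) Sum.inl_ne_inr
  have hi : foot f (σ h i) = f p := by rcases hi with hi | hi <;> rw [hi] <;> rfl
  have := one_le_guardCount hi
  rcases foot_of_eq_or_adj hn hj with hj | hj | hj
  · have := two_le_guardCount hij hi hj
    omega
  all_goals
    have := one_le_guardCount hj
    omega

theorem IsDefenseStrategy.four_le_guardCount_window
    (hσ : IsDefenseStrategy (cycleWithPendents n f) σ) (hn : 2 ≤ n)
    (h : List (cycleWithPendents n f).edgeSet) {p : P} {i : Fin m} (hi : σ h i = Sum.inr p) :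
    4 ≤ 2 * guardCount f (σ h) (f p) + guardCount f (σ h) (f p + 1) +
      guardCount f (σ h) (f p - 1) := by
  have hip : foot f (σ h i) = f p := by rw [hi]; rfl
  have := one_le_guardCount hip
  have beside : ∀ y, (cycleWithPendents n f).Adj (Sum.inl (f p)) (Sum.inl y) →
      2 ≤ guardCount f (σ h) (f p) ∨ 1 ≤ guardCount f (σ h) y := by
    intro y hy
    obtain ⟨j, hj | hj⟩ := hσ.exists_guard_of_adj h hy
    · have hij : i ≠ j := by rintro rfl; exact Sum.inr_ne_inl (hi.symm.trans hj)
      exact Or.inl (two_le_guardCount hij hip (by rw [hj]; rfl))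
    · exact Or.inr (one_le_guardCount (by rw [hj]; rfl))
  have := beside _ ((adj_inl_inl hn).2 (Or.inl rfl))
  have := beside _ ((adj_inl_inl hn).2 (Or.inr rfl))
  omega

end

theorem IsDefenseStrategy.three_mul_lt {k m : ℕ} [NeZero k] {P : Type*} {f : P → Fin (2 * k)}
    {σ : List (cycleWithPendents (2 * k) f).edgeSet → Fin m → Fin (2 * k) ⊕ P}
    (hσ : IsDefenseStrategy (cycleWithPendents (2 * k) f) σ) (hf : ↑(evens k) ⊆ Set.range f) :
    3 * k < 2 * m := by
  have hn := two_le_two_mul k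
  obtain ⟨p, hp⟩ := hf zero_mem_evens
  obtain ⟨h, i, hi⟩ := hσ.exists_history_guard_eq (adj_inl_inr.2 (rfl : f p = f p))
  calc 3 * k = ∑ x ∈ evens k, 3 := by rw [Finset.sum_const, card_evens, smul_eq_mul, mul_comm]
    _ < ∑ x ∈ evens k, (2 * guardCount f (σ h) x + guardCount f (σ h) (x + 1) +
          guardCount f (σ h) (x - 1)) :=
      Finset.sum_lt_sum (fun x hx => hσ.three_le_guardCount_window hn h (hf hx))
        ⟨f p, hp ▸ zero_mem_evens, hσ.four_le_guardCount_window hn h hi⟩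
    _ = 2 * m := by rw [sum_evens_window, sum_guardCount]

end LowerBound

section Relay

variable {k : ℕ} {P : Type*} {S : Set (Fin (2 * k) ⊕ P)}
  {f : P → Fin (2 * k)} {d j x z : Fin (2 * k)} {v w y : Fin (2 * k) ⊕ P}

/-- The neighbours of the cycle vertex `x` that are not in direction `d` (for `d = 1` or
`d = -1`): the preceding cycle vertex and the pendent vertices of `x`. -/
def rear (f : P → Fin (2 * k)) (d x : Fin (2 * k)) : Set (Fin (2 * k) ⊕ P) :=
  insert (Sum.inl (x - d)) (Sum.inr '' (f ⁻¹' {x}))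

theorem inl_mem_rear {a : Fin (2 * k)} : Sum.inl a ∈ rear f d x ↔ a = x - d := by simp [rear]

theorem inr_mem_rear {p : P} : Sum.inr p ∈ rear f d x ↔ f p = x := by simp [rear]

/-- The position from which the guard on `x` is relieved by a move in direction `d`: a guarded
pendent vertex of `x` if there is one, and otherwise the cycle vertex behind `x`. -/
noncomputable def source (f : P → Fin (2 * k)) (d : Fin (2 * k)) (S : Set (Fin (2 * k) ⊕ P))
    (x : Fin (2 * k)) : Fin (2 * k) ⊕ P :=
  open Classical in
  if h : ∃ p, f p = x ∧ Sum.inr p ∈ S then Sum.inr h.choose else Sum.inl (x - d)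

theorem source_eq_inl (h : ¬ ∃ p, f p = x ∧ Sum.inr p ∈ S) : source f d S x = Sum.inl (x - d) :=
  dif_neg h

theorem source_mem_rear : source f d S x ∈ rear f d x := by
  unfold source
  split_ifs with h
  · exact inr_mem_rear.2 h.choose_spec.1
  · exact inl_mem_rear.2 rfl

theorem source_mem_of_mem_rear (hw : w ∈ rear f d x) (hwS : w ∈ S) : source f d S x ∈ S := by
  unfold source
  split_ifs with h
  · exact h.choose_spec.2
  · rcases w with a | p
    · exact inl_mem_rear.1 hw ▸ hwS
    · exact absurd ⟨p, inr_mem_rear.1 hw, hwS⟩ h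

theorem not_exists_pendent_of_source_eq_inl {a : Fin (2 * k)} (h : source f d S x = Sum.inl a) :
    ¬ ∃ p, f p = x ∧ Sum.inr p ∈ S := by
  intro hp
  rw [source, dif_pos hp] at h
  exact Sum.inr_ne_inl h

/-- A relay in direction `d` may end at `x`: either a guarded pendent vertex relieves the guard on
`x`, or the guard behind `x` does and leaves another one behind `x - 2 * d`. -/
def CanStop (f : P → Fin (2 * k)) (d : Fin (2 * k)) (S : Set (Fin (2 * k) ⊕ P))
    (x : Fin (2 * k)) : Prop :=
  (∃ p, f p = x ∧ Sum.inr p ∈ S) ∨ Sum.inl (x - d) ∈ S ∧ Sum.inl (x - d - d - d) ∈ S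

/-- The alternate vertices `j`, `j - 2 * d`, `j - 4 * d`, … up to the first at which a relay in
direction `d` may end. -/
inductive RelayArc (f : P → Fin (2 * k)) (d : Fin (2 * k)) (S : Set (Fin (2 * k) ⊕ P))
    (j : Fin (2 * k)) : Fin (2 * k) → Prop
  | start : RelayArc f d S j j
  | next {x : Fin (2 * k)} : RelayArc f d S j x → ¬ CanStop f d S x → RelayArc f d S j (x - d - d)

variable [NeZero k]

theorem adj_inl_iff (hd : d = 1 ∨ d = -1) :
    (cycleWithPendents (2 * k) f).Adj (Sum.inl x) v ↔ v ∈ rear f d x ∨ v = Sum.inl (x + d) := by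
  rcases v with a | p
  · rw [adj_inl_inl (two_le_two_mul k), inl_mem_rear, Sum.inl.injEq]
    rcases hd with rfl | rfl
    · exact or_comm
    · rw [sub_neg_eq_add, ← sub_eq_add_neg]
  · simp [adj_inl_inr, inr_mem_rear]

theorem eq_of_mem_rear (hx : v ∈ rear f d x) (hz : v ∈ rear f d z) : x = z := by
  rcases v with a | p
  · exact sub_left_injective ((inl_mem_rear.1 hx).symm.trans (inl_mem_rear.1 hz))
  · exact (inr_mem_rear.1 hx).symm.trans (inr_mem_rear.1 hz)

theorem ne_inl_of_mem_rear (hd : d = 1 ∨ d = -1) (hx : x ∈ evens k) (hz : z ∈ evens k)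
    (hv : v ∈ rear f d x) : v ≠ Sum.inl z := by
  rintro rfl
  exact (sub_mem_evens hd).1 (inl_mem_rear.1 hv ▸ hz) hx

theorem exists_opposite_rears
    (hy : (cycleWithPendents (2 * k) f).Adj (Sum.inl x) y)
    (hw : (cycleWithPendents (2 * k) f).Adj (Sum.inl x) w) (hne : y ≠ w) :
    ∃ d, (d = 1 ∨ d = -1) ∧ y ∈ rear f (-d) x ∧ w ∈ rear f d x := by
  rcases y with a | p
  · obtain ⟨d, hd, rfl⟩ : ∃ d, (d = 1 ∨ d = -1) ∧ a = x + d := by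
      rcases (adj_inl_inl (two_le_two_mul k)).1 hy with h | h
      exacts [⟨1, Or.inl rfl, h⟩, ⟨-1, Or.inr rfl, h.trans (sub_eq_add_neg x 1)⟩]
    exact ⟨d, hd, inl_mem_rear.2 (sub_neg_eq_add x d).symm,
      ((adj_inl_iff hd).1 hw).resolve_right hne.symm⟩
  · have hp : ∀ d, Sum.inr p ∈ rear f d x := fun d => inr_mem_rear.2 hy
    rcases (adj_inl_iff (Or.inl rfl)).1 hw with hw | rfl
    exacts [⟨1, Or.inl rfl, hp _, hw⟩,
      ⟨-1, Or.inr rfl, hp _, inl_mem_rear.2 (sub_neg_eq_add x 1).symm⟩]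

theorem exists_canStop (hf : Set.range f ⊆ evens k) (hd : d = 1 ∨ d = -1)
    (hS : 3 * k < 2 * S.ncard) : ∃ t ∈ evens k, CanStop f d S t := by
  rcases exists_surplus hS with ⟨p, hp⟩ | ⟨x, hx, hadd, hsub⟩
  · exact ⟨f p, hf ⟨p, rfl⟩, Or.inl ⟨p, rfl, hp⟩⟩
  · refine ⟨x + d + d, (add_mem_evens hd).2 fun h => (add_mem_evens hd).1 h hx, Or.inr ?_⟩
    simp only [add_sub_cancel_right]
    rcases hd with rfl | rfl
    · exact ⟨hadd, hsub⟩
    · rw [sub_neg_eq_add, ← sub_eq_add_neg]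
      exact ⟨hsub, hadd⟩

namespace RelayArc

theorem mem_evens (hd : d = 1 ∨ d = -1) (hj : j ∈ evens k) (hx : RelayArc f d S j x) :
    x ∈ evens k := by
  induction hx with
  | start => exact hj
  | next _ _ ih => exact (sub_mem_evens hd).2 fun h => (sub_mem_evens hd).1 h ih

theorem add_add (hx : RelayArc f d S j x) (hxj : x ≠ j) :
    RelayArc f d S j (x + d + d) ∧ ¬ CanStop f d S (x + d + d) := by
  cases hx with
  | start => exact absurd rfl hxj
  | next h hfinal => simpa using ⟨h, hfinal⟩

theorem canStop_of_not (hx : RelayArc f d S j (x + d + d)) (hx' : ¬ RelayArc f d S j x) :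
    CanStop f d S (x + d + d) := by
  by_contra hfinal
  exact hx' (by simpa using hx.next hfinal)

theorem sub_sub_ne (hd : d = 1 ∨ d = -1) (hj : j ∈ evens k)
    (hfinal : ∃ t ∈ evens k, CanStop f d S t) (hx : RelayArc f d S j x) (hxs : ¬ CanStop f d S x) :
    x - d - d ≠ j := by
  intro hxj
  obtain rfl : x = j + d + d := by rw [← hxj, sub_add_cancel, sub_add_cancel]
  have closed : ∀ z, RelayArc f d S j z →
      RelayArc f d S j (z + d + d) ∧ ¬ CanStop f d S (z + d + d) := by
    intro z hz
    by_cases hzj : z = j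
    · rw [hzj]
      exact ⟨hx, hxs⟩
    · exact hz.add_add hzj
  obtain ⟨t, ht, hts⟩ := hfinal
  have ht' : t - d - d ∈ evens k := (sub_mem_evens hd).2 fun h => (sub_mem_evens hd).1 h ht
  have harc : RelayArc f d S j (t - d - d) :=
    mem_of_forall_add_add_mem (C := {z | RelayArc f d S j z}) hd hj start
      (fun z hz => (closed z hz).1) ht'
  have h := (closed _ harc).2
  rw [sub_add_cancel, sub_add_cancel] at h
  exact h hts

end RelayArc

/-- The vertices of the relay arc whose guards can be relieved. -/
def activeArc (f : P → Fin (2 * k)) (d : Fin (2 * k)) (S : Set (Fin (2 * k) ⊕ P))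
    (j : Fin (2 * k)) : Set (Fin (2 * k)) :=
  {x | RelayArc f d S j x ∧ source f d S x ∈ S}

/-- The position to which the guard on `x` goes in a relay in direction `d` that starts with the
move from `j` to `y`. -/
def target (d j : Fin (2 * k)) (y : Fin (2 * k) ⊕ P) : Fin (2 * k) → Fin (2 * k) ⊕ P :=
  Function.update (fun x => Sum.inl (x + d)) j y

theorem target_mem_rear (hy : y ∈ rear f (-d) j) : target d j y x ∈ rear f (-d) x := by
  rcases eq_or_ne x j with rfl | hxj
  · rwa [target, Function.update_self]
  · rw [target, Function.update_of_ne hxj, inl_mem_rear, sub_neg_eq_add]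

theorem isRelay_activeArc (hd : d = 1 ∨ d = -1) (hS : ↑(alternateVertices k P) ⊆ S)
    (hj : j ∈ evens k) (hy : y ∈ rear f (-d) j) (hyS : y ∉ S) :
    IsRelay (cycleWithPendents (2 * k) f) S (activeArc f d S j) Sum.inl (source f d S)
      (target d j y) where
  base_injOn := Sum.inl_injective.injOn
  source_injOn _ _ _ _ h := eq_of_mem_rear source_mem_rear (Set.mem_of_eq_of_mem h source_mem_rear)
  target_injOn _ _ _ _ h :=
    eq_of_mem_rear (target_mem_rear hy) (Set.mem_of_eq_of_mem h (target_mem_rear hy))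
  base_mem x hx := hS (inl_mem_alternateVertices.2 (hx.1.mem_evens hd hj))
  source_mem _ hx := hx.2
  source_ne_base _ hx _ hz :=
    ne_inl_of_mem_rear hd (hx.1.mem_evens hd hj) (hz.1.mem_evens hd hj) source_mem_rear
  adj_source _ _ := (adj_inl_iff hd).2 (Or.inl source_mem_rear)
  adj_target _ _ := (adj_inl_iff (neg_eq_one_or hd)).2 (Or.inl (target_mem_rear hy))
  target_vacated x hx hxS := by
    rcases eq_or_ne x j with rfl | hxj
    · rw [target, Function.update_self] at hxS
      exact absurd hxS hyS
    rw [target, Function.update_of_ne hxj] at hxS ⊢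
    obtain ⟨harc, hfinal⟩ := hx.1.add_add hxj
    have hsource : source f d S (x + d + d) = Sum.inl (x + d) := by
      rw [source_eq_inl fun h => hfinal (Or.inl h), add_sub_cancel_right]
    exact ⟨x + d + d, ⟨harc, hsource ▸ hxS⟩, hsource⟩

theorem exists_adj_of_not_relayArc (hd : d = 1 ∨ d = -1)
    (hx : ∃ w ∈ S, (cycleWithPendents (2 * k) f).Adj (Sum.inl x) w)
    (harc : ¬ RelayArc f d S j x) :
    ∃ w ∈ S \ source f d S '' activeArc f d S j,
      (cycleWithPendents (2 * k) f).Adj (Sum.inl x) w := by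
  have rear_kept : ∀ w ∈ rear f d x, w ∈ S → ∃ w ∈ S \ source f d S '' activeArc f d S j,
      (cycleWithPendents (2 * k) f).Adj (Sum.inl x) w := by
    refine fun w hw hwS => ⟨w, ⟨hwS, ?_⟩, (adj_inl_iff hd).2 (Or.inl hw)⟩
    rintro ⟨z, hz, rfl⟩
    exact harc (eq_of_mem_rear source_mem_rear hw ▸ hz.1)
  obtain ⟨w, hwS, hw⟩ := hx
  rcases (adj_inl_iff hd).1 hw with hrear | rfl
  · exact rear_kept w hrear hwS
  by_cases htaken : Sum.inl (x + d) ∈ source f d S '' activeArc f d S j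
  · obtain ⟨z, hz, hzx⟩ := htaken
    obtain rfl : z = x + d + d := by
      rw [← sub_eq_iff_eq_add, eq_comm, ← inl_mem_rear (f := f), ← hzx]
      exact source_mem_rear
    obtain hp | ⟨-, hsub⟩ := hz.1.canStop_of_not harc
    · exact absurd hp (not_exists_pendent_of_source_eq_inl hzx)
    · rw [add_sub_cancel_right, add_sub_cancel_right] at hsub
      exact rear_kept _ (inl_mem_rear.2 rfl) hsub
  · exact ⟨_, ⟨hwS, htaken⟩, hw⟩

theorem exists_adj_target_of_relayArc (hd : d = 1 ∨ d = -1)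
    (hS : Reinforces (cycleWithPendents (2 * k) f) S (alternateVertices k P))
    (hj : j ∈ evens k) (hfinal : ∃ t ∈ evens k, CanStop f d S t) (harc : RelayArc f d S j x)
    (hx : source f d S x ∉ S) :
    ∃ w ∈ target d j y '' activeArc f d S j,
      (cycleWithPendents (2 * k) f).Adj (Sum.inl x) w := by
  have hnext : Sum.inl (x - d) ∉ S := fun h => hx (source_mem_of_mem_rear (inl_mem_rear.2 rfl) h)
  have hxs : ¬ CanStop f d S x := by
    rintro (⟨p, hp, hpS⟩ | ⟨h, -⟩)
    · exact hx (source_mem_of_mem_rear (inr_mem_rear.2 hp) hpS)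
    · exact hnext h
  have harc' := harc.next hxs
  obtain ⟨w, hwS, hw⟩ := hS.exists_adj _ (inl_mem_alternateVertices.2 (harc'.mem_evens hd hj))
  have hactive : source f d S (x - d - d) ∈ S := by
    rcases (adj_inl_iff hd).1 hw with hrear | rfl
    · exact source_mem_of_mem_rear hrear hwS
    · exact absurd hwS (by rwa [sub_add_cancel])
  refine ⟨_, ⟨x - d - d, ⟨harc', hactive⟩, rfl⟩, ?_⟩
  rw [target, Function.update_of_ne (harc.sub_sub_ne hd hj hfinal hxs), sub_add_cancel]
  exact (adj_inl_iff hd).2 (Or.inl (inl_mem_rear.2 rfl))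

theorem exists_defensiveMove_of_notMem (hf : Set.range f ⊆ evens k)
    (hS : Reinforces (cycleWithPendents (2 * k) f) S (alternateVertices k P))
    (hcard : 3 * k < 2 * S.ncard) (hj : j ∈ evens k)
    (hy : (cycleWithPendents (2 * k) f).Adj (Sum.inl j) y) (hyS : y ∉ S) :
    ∃ g, IsDefensiveMove (cycleWithPendents (2 * k) f) S s(Sum.inl j, y) g ∧
      Reinforces (cycleWithPendents (2 * k) f) (g '' S) (alternateVertices k P) := by
  obtain ⟨w, hwS, hw⟩ := hS.exists_adj _ (inl_mem_alternateVertices.2 hj)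
  obtain ⟨d, hd, hy', hw'⟩ := exists_opposite_rears hy hw (ne_of_mem_of_not_mem hwS hyS).symm
  have hfinal := exists_canStop hf hd hcard
  have hR := isRelay_activeArc hd hS.subset hj hy' hyS
  have hj_active : j ∈ activeArc f d S j := ⟨.start, source_mem_of_mem_rear hw' hwS⟩
  have hmove := hR.isDefensiveMove hj_active
  rw [show target d j y j = y from Function.update_self ..] at hmove
  refine ⟨_, hmove, hR.reinforces hS.subset ?_ ?_⟩
  · intro x hx hmem
    obtain ⟨z, hz, hzx⟩ := Finset.mem_map.1 (Finset.mem_coe.1 hmem)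
    exact ne_inl_of_mem_rear hd (hx.1.mem_evens hd hj) hz source_mem_rear hzx.symm
  · refine forall_mem_alternateVertices.2 fun x hx hidle => ?_
    have hx_idle : x ∉ activeArc f d S j := fun h => hidle x h rfl
    by_cases harc : RelayArc f d S j x
    · obtain ⟨u, hu, hxu⟩ :=
        exists_adj_target_of_relayArc hd hS hj hfinal harc fun h => hx_idle ⟨harc, h⟩
      exact ⟨u, Or.inr hu, hxu⟩
    · obtain ⟨u, hu, hxu⟩ :=
        exists_adj_of_not_relayArc hd (hS.exists_adj _ (inl_mem_alternateVertices.2 hx)) harc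
      exact ⟨u, Or.inl hu, hxu⟩

end Relay

section AlternatePendents

variable {k : ℕ} [NeZero k] {P : Type*} {f : P → Fin (2 * k)}

theorem isVertexCover_alternateVertices (hf : Set.range f ⊆ evens k) :
    (cycleWithPendents (2 * k) f).IsVertexCover
      (alternateVertices k P : Set (Fin (2 * k) ⊕ P)) := by
  rintro (a | p) (b | q) h
  · rw [Finset.mem_coe, Finset.mem_coe, inl_mem_alternateVertices, inl_mem_alternateVertices]
    rcases (adj_inl_inl (two_le_two_mul k)).1 h with rfl | rfl
    · rw [add_mem_evens (Or.inl rfl)]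
      exact em _
    · rw [sub_mem_evens (Or.inl rfl)]
      exact em _
  · exact Or.inl (inl_mem_alternateVertices.2 (hf ⟨q, h⟩))
  · exact Or.inr (inl_mem_alternateVertices.2 (hf ⟨p, h⟩))
  · exact h.elim

theorem exists_eq_inl_of_mem_edgeSet (hf : Set.range f ⊆ evens k) {e : Sym2 (Fin (2 * k) ⊕ P)}
    (he : e ∈ (cycleWithPendents (2 * k) f).edgeSet) :
    ∃ j ∈ evens k, ∃ y, (cycleWithPendents (2 * k) f).Adj (Sum.inl j) y ∧ e = s(Sum.inl j, y) := by
  induction e with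
  | _ u v =>
    rcases isVertexCover_alternateVertices hf he with h | h <;>
      obtain ⟨j, hj, rfl⟩ := Finset.mem_map.1 (Finset.mem_coe.1 h)
    exacts [⟨j, hj, v, he, rfl⟩, ⟨j, hj, u, SimpleGraph.Adj.symm he, Sym2.eq_swap⟩]

theorem exists_defensiveMove (hf : Set.range f ⊆ evens k) {S : Set (Fin (2 * k) ⊕ P)}
    (hS : Reinforces (cycleWithPendents (2 * k) f) S (alternateVertices k P))
    (hcard : 3 * k < 2 * S.ncard) {e : Sym2 (Fin (2 * k) ⊕ P)}
    (he : e ∈ (cycleWithPendents (2 * k) f).edgeSet) :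
    ∃ g, IsDefensiveMove (cycleWithPendents (2 * k) f) S e g ∧
      Reinforces (cycleWithPendents (2 * k) f) (g '' S) (alternateVertices k P) := by
  classical
  obtain ⟨j, hj, y, hy, rfl⟩ := exists_eq_inl_of_mem_edgeSet hf he
  by_cases hyS : y ∈ S
  · have hjS : Sum.inl j ∈ S := hS.subset (inl_mem_alternateVertices.2 hj)
    have hswap : Equiv.swap (Sum.inl j) y '' S = S :=
      (Equiv.swap_bijOn_self (iff_of_true hjS hyS)).image_eq
    exact ⟨_, isDefensiveMove_swap hy hjS, hswap.symm ▸ hS⟩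
  · exact exists_defensiveMove_of_notMem hf hS hcard hj hy hyS

theorem exists_finset_near_evens (k : ℕ) [NeZero k] :
    ∃ T : Finset (Fin (2 * k)), T.card ≤ k / 2 + 1 ∧ ∀ x ∈ evens k, x + 1 ∈ T ∨ x - 1 ∈ T := by
  refine ⟨(Finset.range (k / 2 + 1)).image fun i => Fin.ofNat _ (4 * i + 1),
    Finset.card_image_le.trans_eq (Finset.card_range _), fun x hx => ?_⟩
  have hmem := Finset.mem_image_of_mem (fun i => Fin.ofNat (2 * k) (4 * i + 1))
    (Finset.mem_range.2 (show x.val / 4 < k / 2 + 1 by omega))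
  obtain ⟨m, hm⟩ := mem_evens.1 hx
  have hx_mod : x.val % 4 = 0 ∨ x.val % 4 = 2 := by omega
  rcases hx_mod with h | h
  · have hadd : x + 1 = Fin.ofNat (2 * k) (4 * (x.val / 4) + 1) := by
      rw [Nat.mul_div_cancel' (Nat.dvd_of_mod_eq_zero h)]
      simp [Fin.ext_iff, Fin.val_add]
    exact Or.inl (hadd ▸ hmem)
  · have hsub : x - 1 = Fin.ofNat (2 * k) (4 * (x.val / 4) + 1) := by
      have hval : x.val = 4 * (x.val / 4) + 1 + 1 := by omega
      rw [sub_eq_iff_eq_add, Fin.ext_iff, Fin.val_add, Fin.val_one', Fin.val_ofNat,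
        ← Nat.add_mod, ← hval, Nat.mod_eq_of_lt x.isLt]
    exact Or.inr (hsub ▸ hmem)

theorem exists_reinforces (f : P → Fin (2 * k)) :
    ∃ S : Finset (Fin (2 * k) ⊕ P), S.card = k + (k / 2 + 1) ∧
      Reinforces (cycleWithPendents (2 * k) f) S (alternateVertices k P) := by
  classical
  obtain ⟨T, hTcard, hT⟩ := exists_finset_near_evens k
  have hcard : (evens k ∪ T).card ≤ k + (k / 2 + 1) :=
    (Finset.card_union_le _ _).trans (Nat.add_le_add (card_evens k).le hTcard)
  have hle : k + (k / 2 + 1) ≤ Fintype.card (Fin (2 * k)) := by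
    have := NeZero.pos k
    rw [Fintype.card_fin]
    omega
  obtain ⟨W, hW, hWcard⟩ := Finset.exists_superset_card_eq hcard hle
  have inl_mem {a : Fin (2 * k)} (ha : a ∈ T) :
      Sum.inl a ∈ W.map (Function.Embedding.inl : _ ↪ Fin (2 * k) ⊕ P) :=
    Finset.mem_map_of_mem _ (hW (Finset.mem_union_right _ ha))
  refine ⟨W.map Function.Embedding.inl, by rwa [Finset.card_map],
    Finset.coe_subset.2 (Finset.map_subset_map.2 (Finset.union_subset_left hW)),
    forall_mem_alternateVertices.2 fun x hx => ?_⟩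
  rcases hT x hx with h | h
  exacts [⟨_, inl_mem h, (adj_inl_inl (two_le_two_mul k)).2 (Or.inl rfl)⟩,
    ⟨_, inl_mem h, (adj_inl_inl (two_le_two_mul k)).2 (Or.inr rfl)⟩]

theorem exists_injective_strategy_cycleWithPendents (hf : Set.range f ⊆ evens k) :
    ∃ σ : List (cycleWithPendents (2 * k) f).edgeSet → Fin (k + (k / 2 + 1)) → Fin (2 * k) ⊕ P,
      IsDefenseStrategy (cycleWithPendents (2 * k) f) σ ∧ ∀ h, Function.Injective (σ h) := by
  obtain ⟨S₀, hcard, hS₀⟩ := exists_reinforces f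
  rw [← hcard]
  refine exists_injective_strategy (fun S => 3 * k < 2 * S.ncard ∧
    Reinforces (cycleWithPendents (2 * k) f) S (alternateVertices k P)) ?_ S₀ ⟨?_, hS₀⟩
  · rintro S ⟨hlt, hS⟩ e he
    obtain ⟨g, hg, hgS⟩ := exists_defensiveMove hf hS hlt he
    exact ⟨g, hg, by rwa [hg.injOn.ncard_image], hgS⟩
  · rw [Set.ncard_coe_finset]
    omega

theorem evc_cycleWithPendents (hf : Set.range f = evens k) :
    evc (cycleWithPendents (2 * k) f) = k + (k / 2 + 1) := by
  obtain ⟨σ, hσ, -⟩ := exists_injective_strategy_cycleWithPendents hf.subset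
  refine evc_eq hσ fun m τ hτ => ?_
  have := hτ.three_mul_lt hf.superset
  omega

theorem evcSingle_cycleWithPendents (hf : Set.range f = evens k) :
    evcSingle (cycleWithPendents (2 * k) f) = k + (k / 2 + 1) := by
  obtain ⟨σ, hσ, hinj⟩ := exists_injective_strategy_cycleWithPendents hf.subset
  refine evcSingle_eq hσ hinj fun m τ hτ => ?_
  have := hτ.three_mul_lt hf.superset
  omega

theorem le_card_of_isVertexCover (hf : ↑(evens k) ⊆ Set.range f)
    {D : Finset (Fin (2 * k) ⊕ P)}
    (hD : (cycleWithPendents (2 * k) f).IsVertexCover (D : Set (Fin (2 * k) ⊕ P))) :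
    k ≤ D.card := by
  calc k = (evens k : Set (Fin (2 * k))).ncard := by rw [Set.ncard_coe_finset, card_evens]
    _ ≤ (Set.range f).ncard := Set.ncard_le_ncard hf
    _ ≤ D.card := ncard_range_le_card_of_isVertexCover hD

theorem cutVertices_subset_alternateVertices (hf : Set.range f ⊆ evens k) :
    cutVertices (cycleWithPendents (2 * k) f) ⊆ alternateVertices k P := by
  rw [alternateVertices, Finset.coe_map]
  exact (cutVertices_cycleWithPendents_subset (two_le_two_mul k) f).trans (Set.image_mono hf)

theorem mvcX_cycleWithPendents (hf : Set.range f = evens k) :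
    mvcX (cycleWithPendents (2 * k) f) = k := by
  have hmem : ∃ C : Finset (Fin (2 * k) ⊕ P),
      (cycleWithPendents (2 * k) f).IsVertexCover (C : Set (Fin (2 * k) ⊕ P)) ∧
      cutVertices (cycleWithPendents (2 * k) f) ⊆ C ∧ C.card = k :=
    ⟨alternateVertices k P, isVertexCover_alternateVertices hf.subset,
      cutVertices_subset_alternateVertices hf.subset, card_alternateVertices k P⟩
  exact le_antisymm (Nat.sInf_le hmem)
    (le_csInf ⟨k, hmem⟩ fun n ⟨D, hD, _, hn⟩ => hn ▸ le_card_of_isVertexCover hf.superset hD)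

end AlternatePendents

theorem ceil_add_one_div_two (k : ℕ) : ⌈((k : ℝ) + 1) / 2⌉₊ = k / 2 + 1 := by
  rw [Nat.ceil_eq_iff (Nat.add_one_ne_zero _), Nat.add_sub_cancel, lt_div_iff₀ two_pos,
    div_le_iff₀ two_pos]
  constructor <;> norm_cast <;> omega

theorem three_halves_mul_lt (k : ℕ) :
    (3 / 2 : ℝ) * k < ((k + (k / 2 + 1) : ℕ) : ℝ) := by
  rw [div_mul_eq_mul_div, div_lt_iff₀ two_pos]
  norm_cast
  omega

theorem mainTheorem11_general (k : ℕ) [NeZero k] {P : Type*} (f : P → Fin (2 * k))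
    (hf : ∀ a : Fin (2 * k), (∃ p, f p = a) ↔ Even a.val) :
    IsCactus (cycleWithPendents (2 * k) f) ∧
    (∃ C : Finset (Fin (2 * k) ⊕ P),
      (cycleWithPendents (2 * k) f).IsVertexCover (C : Set (Fin (2 * k) ⊕ P)) ∧
      C.card = k ∧
      (∀ D : Finset (Fin (2 * k) ⊕ P),
        (cycleWithPendents (2 * k) f).IsVertexCover (D : Set (Fin (2 * k) ⊕ P)) →
          C.card ≤ D.card) ∧
      cutVertices (cycleWithPendents (2 * k) f) ⊆ (C : Set (Fin (2 * k) ⊕ P))) ∧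
    mvcX (cycleWithPendents (2 * k) f) = k ∧
    evc (cycleWithPendents (2 * k) f) = k + ⌈((k : ℝ) + 1) / 2⌉₊ ∧
    evcSingle (cycleWithPendents (2 * k) f) = k + ⌈((k : ℝ) + 1) / 2⌉₊ ∧
    (3 / 2 : ℝ) * (mvcX (cycleWithPendents (2 * k) f) : ℝ) <
      (evc (cycleWithPendents (2 * k) f) : ℝ) ∧
    (3 / 2 : ℝ) * (mvcX (cycleWithPendents (2 * k) f) : ℝ) <
      (evcSingle (cycleWithPendents (2 * k) f) : ℝ) := by
  have hrange : Set.range f = evens k := by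
    ext a
    rw [Finset.mem_coe, mem_evens]
    exact hf a
  rw [mvcX_cycleWithPendents hrange, evc_cycleWithPendents hrange,
    evcSingle_cycleWithPendents hrange, ceil_add_one_div_two]
  refine ⟨isCactus_cycleWithPendents (two_le_two_mul k) f, ⟨alternateVertices k P,
      isVertexCover_alternateVertices hrange.subset, card_alternateVertices k P, ?_,
      cutVertices_subset_alternateVertices hrange.subset⟩,
    rfl, rfl, rfl, three_halves_mul_lt k, three_halves_mul_lt k⟩
  intro D hD
  rw [card_alternateVertices]
  exact le_card_of_isVertexCover hrange.superset hD

theorem mainTheorem11 (k : ℕ) (hk : 2 ≤ k) {P : Type*} [Finite P] (f : P → Fin (2 * k))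
    (hf : ∀ a : Fin (2 * k), (∃ p, f p = a) ↔ Even a.val) :
    IsCactus (cycleWithPendents (2 * k) f) ∧
    (∃ C : Finset (Fin (2 * k) ⊕ P),
      (cycleWithPendents (2 * k) f).IsVertexCover (C : Set (Fin (2 * k) ⊕ P)) ∧
      C.card = k ∧
      (∀ D : Finset (Fin (2 * k) ⊕ P),
        (cycleWithPendents (2 * k) f).IsVertexCover (D : Set (Fin (2 * k) ⊕ P)) →
          C.card ≤ D.card) ∧
      cutVertices (cycleWithPendents (2 * k) f) ⊆ (C : Set (Fin (2 * k) ⊕ P))) ∧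
    mvcX (cycleWithPendents (2 * k) f) = k ∧
    evc (cycleWithPendents (2 * k) f) = k + ⌈((k : ℝ) + 1) / 2⌉₊ ∧
    evcSingle (cycleWithPendents (2 * k) f) = k + ⌈((k : ℝ) + 1) / 2⌉₊ ∧
    (3 / 2 : ℝ) * (mvcX (cycleWithPendents (2 * k) f) : ℝ) <
      (evc (cycleWithPendents (2 * k) f) : ℝ) ∧
    (3 / 2 : ℝ) * (mvcX (cycleWithPendents (2 * k) f) : ℝ) <
      (evcSingle (cycleWithPendents (2 * k) f) : ℝ) := by
  have : NeZero k := ⟨by omega⟩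
  exact mainTheorem11_general k f hf
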